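/- **Setting.** Two organizations maintain a mainchain $\mathsf{MC}$ and a sidechain $\mathsf{SC}$; there is no common clock. Let $k$ be the common prefix parameter; a transaction is *stable* for a node if it is in a block more than $k$ blocks away from the last block of that node's ledger. $\mathsf{L}_{\mathsf{MC}}$ and $\mathsf{L}_{\mathsf{SC}}$ denote the stable ledgers. Honest nodes are those that are never corrupted; honest nodes hold as stable only transactions that a majority of their organization has approved. *Persistence*: honest nodes agree on the stable blocks and their positions and never lose them. *Liveness*: a transaction submitted by an honest node eventually is stable for every honest node. A transaction *appears* in a ledger if it is stable for some honest node at some time, and is *recorded* in it if from some time on it is stable for all honest nodes. **Protocol AsyncSC** (from $\mathsf{MC}$ to $\mathsf{SC}$), over a delayed aggregate signature scheme (DAS) with algorithms $\mathtt{ParGen},\mathtt{KeyGen},\mathtt{Sig},\mathtt{Ver},\mathtt{KeyAgg},\mathtt{AKCheck},\mathtt{DASig},\mathtt{DASVer}$. A cross-chain transaction $\mathsf{CTx}$ has a sending half $\mathsf{CTx}^{\mathsf{send}}$ for $\mathsf{MC}$ and a receiving half $\mathsf{CTx}^{\mathsf{recv}}$ for $\mathsf{SC}$ with the same data; a half is *as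 expected* if it belongs to a $\mathsf{CTx}$ agreed upon by the two organizations. Honest nodes behave as follows. 1. In each epoch, the initiated $\mathsf{CTx}$s that are as expected are packed into an ordered $\mathsf{CTxSet}$. Honest members of the $\mathsf{MC}$ committee of the epoch submit their sending halves to $\mathsf{MC}$, the last one at least $T_{LastCTx}$ before the end of the epoch; honest $\mathsf{MC}$ nodes submit or approve no other sending halves. 2. At least $T_{Sig}$ after the end of the epoch each honest committee member signs $\mathsf{CTxSet}$ (with the epoch number); honest nodes sign nothing else. 3. When more than half of the committee has issued verifying signatures, honest committee members (the leader, elected by highest election value, at once; the others after the response threshold $\Delta_{async}>0$) aggregate the signatures of a majority with $\mathtt{DASig}$, which takes a delay $\delta$, and send the resulting proof ACP to the nodes of $\mathsf{SC}$, and again after each further $\Delta_{async}$ until the receiving halves of the epoch are seen to be stable on $\mathsf{SC}$. 4. An honest $\mathsf{SC}$ node submits $\mathsf{CTx}^{\mathsf{recv}}$ once, and submits or approves it only if, it has received an ACP containing $\mathsf{CTx}$ whose alleged signers form a majority of the committee and which passes $\mathtt{AKCheck}$ and $\mathtt{DASVer}$, and the receiving halves of all preceding $\mathsf{CTx}$s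 (in order of epochs, then within $\mathsf{CTxSet}$) are already stable for it. Corrupted nodes and the network behave arbitrarily. **Theorem.** Let the DAS be correct: $\mathtt{AKCheck}$ accepts exactly the output of $\mathtt{KeyAgg}$, honest signatures verify, and aggregates of verifying signatures verify. Consider random runs of AsyncSC, indexed by a security parameter $\lambda$, against an adversary such that each of the following holds except with probability negligible in $\lambda$: - a strict majority of the nodes of each organization and of each committee is honest; - the delay between the chains is finite, though not bounded: an ACP that an honest $\mathsf{MC}$ node sends to an honest $\mathsf{SC}$ node infinitely often is received at some time; - the DAS is not broken: honest $\mathsf{SC}$ nodes never receive an ACP that passes $\mathtt{AKCheck}$ and $\mathtt{DASVer}$ although an honest node among its alleged signers has not signed its message at least $\delta$ earlier; - $\mathsf{MC}$ satisfies persistence and liveness; - $\mathsf{SC}$ satisfies persistence and liveness. Then AsyncSC is secure: except with probability negligible in $\lambda$, the run has both of the following properties. - **Correctness.** (i) If $\mathsf{CTx}$ is initiated and $\mathsf{CTx}^{\mathsf{send}}$ and $\mathsf{CTx}^{\mathsf{recv}}$ are as expected, they are recorded in $\mathsf{L}_{\mathsf{MC}}$ and $\mathsf{L}_{\mathsf{SC}}$,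 respectively. (ii) If either is not as expected, neither ever appears in the respective ledger. (iii) It never remains at one half: if $\mathsf{CTx}^{\mathsf{send}}$ appears in $\mathsf{L}_{\mathsf{MC}}$, then $\mathsf{CTx}^{\mathsf{recv}}$ is recorded in $\mathsf{L}_{\mathsf{SC}}$, and if $\mathsf{CTx}^{\mathsf{recv}}$ appears in $\mathsf{L}_{\mathsf{SC}}$, then $\mathsf{CTx}^{\mathsf{send}}$ is recorded in $\mathsf{L}_{\mathsf{MC}}$. (iv) If transactions of honest nodes are stable on $\mathsf{MC}$ within time $T_{Stab}$ and $\delta \ge T_{Stab}-T_{LastCTx}-T_{Sig}$ in every epoch, then whenever $\mathsf{CTx}^{\mathsf{recv}}$ is stable for some honest node of $\mathsf{SC}$, $\mathsf{CTx}^{\mathsf{send}}$ is already stable for all honest nodes of $\mathsf{MC}$. - **Stability.** If $\mathsf{CTx}$ is initiated and $\mathsf{CTx}^{\mathsf{send}}$ is as expected, then from some time on $\mathsf{CTx}^{\mathsf{send}}$ and $\mathsf{CTx}^{\mathsf{recv}}$ are in blocks more than $k$ blocks away from the ends of $\mathsf{L}_{\mathsf{MC}}$ and $\mathsf{L}_{\mathsf{SC}}$,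 respectively, for all honest nodes. -/

import Mathlib

open MeasureTheory Filter

namespace AsyncSC

/-! ### Delayed aggregate signatures -/

/-- The eight algorithms of a delayed aggregate signature scheme on messages `Msg`.
A randomized algorithm returns a probability mass function on its outputs. -/
structure DAS (Msg : Type) where
  SysPar : Type
  EvalKey : Type
  VerKey : Type
  PubKey : Type
  SecKey : Type
  Sgn : Type
  AggKey : Type
  AggSgn : Type
  Prf : Type
  Out : Type
  ParGen : ℕ → ℕ → PMF (SysPar × EvalKey × VerKey)
  KeyGen : SysPar → PMF (PubKey × SecKey)
  Sig : SecKey → Msg → PMF Sgn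
  Ver : Msg → PubKey → Sgn → Bool
  KeyAgg : List PubKey → AggKey
  AKCheck : List PubKey → AggKey → Bool
  DASig : Msg → List PubKey → List (PubKey × Sgn) → EvalKey → PMF (AggSgn × Prf × Out)
  DASVer : Msg → AggKey → AggSgn → Prf → Out → VerKey → Bool

/-- Correctness of the scheme: `AKCheck` recomputes the aggregate key, honestly made signatures
verify, and whatever `DASig` makes from verifying signatures on one message verifies. -/
def DAS.Correct {Msg : Type} (D : DAS Msg) : Prop :=
  (∀ PK apk, D.AKCheck PK apk = true ↔ apk = D.KeyAgg PK) ∧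
  ∀ n t sp ek vk, (sp, ek, vk) ∈ (D.ParGen n t).support →
    (∀ pk sk, (pk, sk) ∈ (D.KeyGen sp).support →
      ∀ M, ∀ σ ∈ (D.Sig sk M).support, D.Ver M pk σ = true) ∧
    (∀ M (L : List (D.PubKey × D.Sgn)), L ≠ [] → (∀ p ∈ L, D.Ver M p.1 p.2 = true) →
      ∀ out ∈ (D.DASig M (L.map Prod.fst) L ek).support,
        D.DASVer M (D.KeyAgg (L.map Prod.fst)) out.1 out.2.1 out.2.2 vk = true)

/-- A signed message with everything needed to verify it: an asynchronous cross-chain proof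
(the verification key is public and not repeated). `signers` lists who is claimed to have
signed. -/
structure ACP {Msg : Type} (D : DAS Msg) (N : Type) where
  signers : List N
  msg : Msg
  apk : D.AggKey
  sig : D.AggSgn
  prf : D.Prf
  out : D.Out

/-- The two public checks: the aggregate key belongs to the claimed signers, and the delayed
aggregate signature verifies under it. -/
def ACP.Verifies {Msg : Type} {D : DAS Msg} {N : Type} (pk : N → D.PubKey) (vk : D.VerKey)
    (a : ACP D N) : Prop :=
  D.AKCheck (a.signers.map pk) a.apk = true ∧
  D.DASVer a.msg a.apk a.sig a.prf a.out vk = true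

/-- Transcript of a chosen-message attack on the scheme. The public keys of dishonest signers
are arbitrary, and dishonest signers need no record in `signed`. -/
structure DAS.Attack {Msg : Type} (D : DAS Msg) (N : Type) where
  honest : Set N
  pk : N → D.PubKey
  vk : D.VerKey
  /-- `signed i u M σ`: signer `i` released the signature `σ` on `M` at time `u`. -/
  signed : N → ℕ → Msg → D.Sgn → Prop
  /-- `output t a`: the value `a` is available at time `t`. -/
  output : ℕ → ACP D N → Prop

/-- The attack wins if some available value verifies although one of its alleged signers is
honest and has not signed the message at least `δ` time units before: the value is a forgery,
or it was computed faster than the delay allows. -/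
def DAS.Attack.Wins {Msg : Type} {D : DAS Msg} {N : Type} (A : D.Attack N) (δ : ℕ) : Prop :=
  ∃ t a, A.output t a ∧ a.Verifies A.pk A.vk ∧
    ∃ q ∈ a.signers, q ∈ A.honest ∧ ¬ ∃ u σ, u + δ ≤ t ∧ A.signed q u a.msg σ

/-! ### Ledgers -/

/-- Transactions on a ledger: the two halves of a cross-chain transaction `c : C`, and
transactions of no concern to other chains. -/
inductive Tx (C X : Type) where
  | send (c : C)
  | recv (c : C)
  | intra (x : X)

/-- A strict majority of the nodes in `S` has property `p`. -/
noncomputable def Majority {N : Type} (S : Finset N) (p : N → Prop) : Prop :=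
  S.card < 2 * {i ∈ (S : Set N) | p i}.ncard

/-- One run of a blockchain maintained by the nodes in `org`. Times are those of an outside
observer; the nodes have no clocks in common. -/
structure Chain (N T : Type) where
  org : Finset N
  /-- the nodes that are never corrupted -/
  honest : Set N
  /-- the ledger, as a list of blocks, that a node holds at a time -/
  view : N → ℕ → List (List T)
  /-- a node hands in a transaction for recording at a time -/
  submit : N → ℕ → T → Prop
  /-- a node approves the recording of a transaction at a time -/
  endorse : N → ℕ → T → Prop

namespace Chain

variable {N T : Type}

def Honest (L : Chain N T) (i : N) : Prop := i ∈ L.org ∧ i ∈ L.honest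

/-- Node `i` holds, at time `t`, the block `b` at height `h`, more than `k` blocks away from
the last block. -/
def StableBlock (L : Chain N T) (k : ℕ) (i : N) (t h : ℕ) (b : List T) : Prop :=
  (L.view i t)[h]? = some b ∧ h + k < (L.view i t).length - 1

/-- Transaction `x` is in the stable part of the ledger of node `i` at time `t`. -/
def Stable (L : Chain N T) (k : ℕ) (i : N) (t : ℕ) (x : T) : Prop :=
  ∃ h b, L.StableBlock k i t h b ∧ x ∈ b

/-- From some time on, `x` is in the stable part of the ledger of every honest node. -/
def Recorded (L : Chain N T) (k : ℕ) (x : T) : Prop :=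
  ∃ t₀, ∀ t, t₀ ≤ t → ∀ i, L.Honest i → L.Stable k i t x

/-- At some time `x` is in the stable part of the ledger of some honest node. -/
def Appears (L : Chain N T) (k : ℕ) (x : T) : Prop :=
  ∃ t i, L.Honest i ∧ L.Stable k i t x

/-- Honest nodes agree on stable blocks and their heights, and never lose them. -/
def Persistence (L : Chain N T) (k : ℕ) : Prop :=
  (∀ i j, L.Honest i → L.Honest j → ∀ t t' h b b',
    L.StableBlock k i t h b → L.StableBlock k j t' h b' → b = b') ∧
  (∀ i, L.Honest i → ∀ t t', t ≤ t' → ∀ h b,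
    L.StableBlock k i t h b → L.StableBlock k i t' h b)

/-- What an honest node hands in is eventually in the stable ledger of every honest node. -/
def Liveness (L : Chain N T) (k : ℕ) : Prop :=
  ∀ i, L.Honest i → ∀ s x, L.submit i s x → ∀ j, L.Honest j → ∃ t, s ≤ t ∧ L.Stable k j t x

/-- Transactions of honest nodes take time at most `d` to stabilize. -/
def StabilizesWithin (L : Chain N T) (k d : ℕ) : Prop :=
  ∀ i, L.Honest i → ∀ s x, L.submit i s x →
    ∀ t, s + d ≤ t → ∀ j, L.Honest j → L.Stable k j t x

def HonestMajority (L : Chain N T) : Prop := Majority L.org (· ∈ L.honest)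

/-- The rule by which honest nodes extend their ledgers: what they hold as stable has been
approved by a majority of the nodes. -/
def RecordsOnlyEndorsed (L : Chain N T) (k : ℕ) : Prop :=
  ∀ i, L.Honest i → ∀ t x, L.Stable k i t x →
    Majority L.org (fun j => ∃ s ≤ t, L.endorse j s x)

end Chain

/-! ### The protocol -/

/-- Parameters: common prefix parameter `k`, delay parameter `t` of the signature scheme and the
delay `δ` it causes, duration `tSig` of the committee signing, response threshold `Δasync`. -/
structure Params where
  k : ℕ
  t : ℕ
  δ : ℕ
  tSig : ℕ
  Δasync : ℕ

/-- Everything that happens in one run in which cross-chain transactions go from the chain `mc`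
to the chain `sc`. A message is an epoch with the sequence of transactions packed for it. This
is a record without constraints; `FollowsProtocol` says what honest nodes do. -/
structure Execution (NM NS C X : Type) (D : DAS (ℕ × List C)) where
  mc : Chain NM (Tx C X)
  sc : Chain NS (Tx C X)
  /-- the cross-chain transactions agreed on by the two organizations -/
  agreed : C → Prop
  /-- the cross-chain transactions initiated in an epoch, in the order of the buffer pool -/
  batch : ℕ → List C
  /-- the time at which an epoch ends and its transactions are with the committee -/
  packTime : ℕ → ℕ
  /-- time from the last submission in an epoch to the end of the epoch -/
  tLast : ℕ → ℕ
  committee : ℕ → Finset NM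
  elecVal : ℕ → NM → ℕ
  leader : ℕ → NM
  sysPar : D.SysPar
  ek : D.EvalKey
  vk : D.VerKey
  pk : NM → D.PubKey
  sk : NM → D.SecKey
  /-- `signed i u M σ`: node `i` releases the signature `σ` on `M` to the committee at `u` -/
  signed : NM → ℕ → ℕ × List C → D.Sgn → Prop
  /-- `transmit i j t a`: node `i` of `mc` sends `a` to node `j` of `sc` at time `t` -/
  transmit : NM → NS → ℕ → ACP D NM → Prop
  /-- `received j t a`: node `j` of `sc` obtains `a`, from anyone, at time `t` -/
  received : NS → ℕ → ACP D NM → Prop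
  /-- `confirmed i e t`: at time `t` node `i` of `mc` takes epoch `e` to be completed -/
  confirmed : NM → ℕ → ℕ → Prop

namespace Execution

variable {NM NS C X : Type} {D : DAS (ℕ × List C)}

/-- A half of a cross-chain transaction is as expected if it is the half of an agreed one. -/
def AsExpected (E : Execution NM NS C X D) : Tx C X → Prop
  | .send c => E.agreed c
  | .recv c => E.agreed c
  | .intra _ => True

open Classical in
/-- What is packed for epoch `e`: the initiated transactions, without those that are not as
expected. -/
noncomputable def ctxSet (E : Execution NM NS C X D) (e : ℕ) : List C :=
  (E.batch e).filter (fun c => E.AsExpected (.send c) ∧ E.AsExpected (.recv c))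

noncomputable def ctxMsg (E : Execution NM NS C X D) (e : ℕ) : ℕ × List C := (e, E.ctxSet e)

/-- `Q` is a list of distinct members, more than half, of the committee of epoch `e`. -/
def IsQuorum (E : Execution NM NS C X D) (e : ℕ) (Q : List NM) : Prop :=
  Q.Nodup ∧ (∀ q ∈ Q, q ∈ E.committee e) ∧ (E.committee e).card < 2 * Q.length

/-- By time `t` the members in `Q` have released verifying signatures `σ` for epoch `e`. -/
def QuorumSigned (E : Execution NM NS C X D) (e : ℕ) (Q : List NM) (σ : NM → D.Sgn)
    (t : ℕ) : Prop :=
  E.IsQuorum e Q ∧ ∀ q ∈ Q, (∃ u ≤ t, E.signed q u (E.ctxMsg e) (σ q)) ∧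
    D.Ver (E.ctxMsg e) (E.pk q) (σ q) = true

/-- The proof `a` results from delayed aggregation of the signatures `σ` of `Q` for epoch `e`. -/
def AggregatedFrom (E : Execution NM NS C X D) (e : ℕ) (Q : List NM) (σ : NM → D.Sgn)
    (a : ACP D NM) : Prop :=
  a.signers = Q ∧ a.msg = E.ctxMsg e ∧ a.apk = D.KeyAgg (Q.map E.pk) ∧
  (a.sig, a.prf, a.out) ∈
    (D.DASig (E.ctxMsg e) (Q.map E.pk) (Q.map (fun q => (E.pk q, σ q))) E.ek).support

/-- The verification of a received proof on `sc`. -/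
def Accepts (E : Execution NM NS C X D) (a : ACP D NM) : Prop :=
  E.IsQuorum a.msg.1 a.signers ∧ a.Verifies E.pk E.vk

/-- What a node of `sc` requires at time `t` for the receiving half of `c`: an accepted proof
whose message contains `c`, and the sequential check, that is, the receiving halves of all
preceding transactions (the earlier ones in the message, and all those that the buffer pool
holds for earlier epochs) are in its stable ledger. -/
def RecvCheck (E : Execution NM NS C X D) (k : ℕ) (j : NS) (t : ℕ) (c : C) : Prop :=
  ∃ a : ACP D NM, (∃ s ≤ t, E.received j s a) ∧ E.Accepts a ∧
    ∃ n, a.msg.2[n]? = some c ∧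
      (∀ c' ∈ a.msg.2.take n, E.sc.Stable k j t (.recv c')) ∧
      (∀ e' < a.msg.1, ∀ c' ∈ E.ctxSet e', E.sc.Stable k j t (.recv c'))

/-- The set-up with security parameter `n`: public parameters, keys of honest nodes, committees,
and leaders with highest election value. -/
def SetUp (E : Execution NM NS C X D) (n : ℕ) (P : Params) : Prop :=
  (E.sysPar, E.ek, E.vk) ∈ (D.ParGen n P.t).support ∧
  (∀ i, E.mc.Honest i → (E.pk i, E.sk i) ∈ (D.KeyGen E.sysPar).support) ∧
  (∀ e, E.committee e ⊆ E.mc.org ∧ E.leader e ∈ E.committee e ∧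
    ∀ i ∈ E.committee e, E.elecVal e i ≤ E.elecVal e (E.leader e))

/-- Initiation: honest nodes of `mc` submit and approve the sending half only of packed
transactions, and honest committee members submit all of those, during the epoch. -/
def InitiationRule (E : Execution NM NS C X D) : Prop :=
  (∀ i, E.mc.Honest i → ∀ t c,
    E.mc.submit i t (.send c) ∨ E.mc.endorse i t (.send c) → ∃ e, c ∈ E.ctxSet e) ∧
  (∀ e, ∀ i ∈ E.committee e, E.mc.Honest i → ∀ c ∈ E.ctxSet e,
    ∃ s, s + E.tLast e ≤ E.packTime e ∧ E.mc.submit i s (.send c))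

/-- Signing: an honest member of the committee of epoch `e` signs what is packed for `e`, when
the epoch has ended; honest nodes sign nothing else. -/
def SigningRule (E : Execution NM NS C X D) (P : Params) : Prop :=
  (∀ e, ∀ i ∈ E.committee e, E.mc.Honest i → ∃ u σ, E.signed i u (E.ctxMsg e) σ) ∧
  (∀ i, E.mc.Honest i → ∀ u M σ, E.signed i u M σ →
    ∃ e, i ∈ E.committee e ∧ M = E.ctxMsg e ∧ E.packTime e + P.tSig ≤ u ∧
      σ ∈ (D.Sig (E.sk i) M).support)

/-- Generation and (re)transmission of proofs: once a quorum has signed, each honest committee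
member aggregates verifying signatures of a quorum, the leader at once and the others when the
response threshold has passed, and sends the result to the nodes of `sc`, again after every
further passing of the threshold, as long as the epoch is not confirmed. It is taken to be
confirmed only if the ledger of `sc` shows its receiving halves as stable. -/
def TransmissionRule (E : Execution NM NS C X D) (P : Params) : Prop :=
  (∀ e, ∀ i ∈ E.committee e, E.mc.Honest i → (∃ Q σ t, E.QuorumSigned e Q σ t) →
    ∃ Q σ t r a, E.QuorumSigned e Q σ t ∧ t + P.δ ≤ r ∧
      (i ≠ E.leader e → E.packTime e + P.Δasync ≤ r) ∧ E.AggregatedFrom e Q σ a ∧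
      ∀ m, ¬ E.confirmed i e (r + m * P.Δasync) →
        ∀ j ∈ E.sc.org, E.transmit i j (r + m * P.Δasync) a) ∧
  (∀ i, E.mc.Honest i → ∀ e t, E.confirmed i e t →
    ∃ j, E.sc.Honest j ∧ ∀ c ∈ E.ctxSet e, E.sc.Stable P.k j t (.recv c))

/-- Completion: honest nodes of `sc` submit and approve receiving halves only if the check
passes, and if it passes, they submit them. -/
def CompletionRule (E : Execution NM NS C X D) (P : Params) : Prop :=
  ∀ j, E.sc.Honest j → ∀ c,
    (∀ t, E.sc.submit j t (.recv c) ∨ E.sc.endorse j t (.recv c) → E.RecvCheck P.k j t c) ∧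
    (∀ t, E.RecvCheck P.k j t c → ∃ s, E.sc.submit j s (.recv c))

/-- The honest nodes follow the protocol; everybody else, and the network, do what they like. -/
def FollowsProtocol (E : Execution NM NS C X D) (n : ℕ) (P : Params) : Prop :=
  E.SetUp n P ∧ E.mc.RecordsOnlyEndorsed P.k ∧ E.sc.RecordsOnlyEndorsed P.k ∧
  E.InitiationRule ∧ E.SigningRule P ∧ E.TransmissionRule P ∧ E.CompletionRule P

/-- Honest majorities in both organizations and in every committee. -/
def HonestMajorities (E : Execution NM NS C X D) : Prop :=
  E.mc.HonestMajority ∧ E.sc.HonestMajority ∧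
  ∀ e, Majority (E.committee e) (· ∈ E.mc.honest)

/-- The delay between the chains is unbounded but not infinite: what an honest node of `mc`
keeps sending to an honest node of `sc` gets there at some time. -/
def FiniteDelay (E : Execution NM NS C X D) : Prop :=
  ∀ i j, E.mc.Honest i → E.sc.Honest j → ∀ a,
    (∀ t₀, ∃ t, t₀ ≤ t ∧ E.transmit i j t a) → ∃ t, E.received j t a

/-- The run, seen as an attack on the signature scheme: the signers are the nodes of `mc`, and
the outputs are what honest nodes of `sc` obtain. -/
def dasAttack (E : Execution NM NS C X D) : D.Attack NM where
  honest := {i | E.mc.Honest i}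
  pk := E.pk
  vk := E.vk
  signed := E.signed
  output := fun t a => ∃ j, E.sc.Honest j ∧ E.received j t a

/-! ### Security -/

def Initiated (E : Execution NM NS C X D) (c : C) : Prop := ∃ e, c ∈ E.batch e

/-- Both halves are recorded if they are as expected; neither is ever recorded if one is not;
and in no case does it remain at one half. The receiving half is moreover never even ahead of
the sending half if the delay covers the time `d` that stabilization takes on `mc`. -/
def Correctness (E : Execution NM NS C X D) (P : Params) : Prop :=
  (∀ c, E.Initiated c → E.AsExpected (.send c) → E.AsExpected (.recv c) →
    E.mc.Recorded P.k (.send c) ∧ E.sc.Recorded P.k (.recv c)) ∧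
  (∀ c, ¬ E.AsExpected (.send c) ∨ ¬ E.AsExpected (.recv c) →
    ¬ E.mc.Appears P.k (.send c) ∧ ¬ E.sc.Appears P.k (.recv c)) ∧
  (∀ c, E.mc.Appears P.k (.send c) → E.sc.Recorded P.k (.recv c)) ∧
  (∀ c, E.sc.Appears P.k (.recv c) → E.mc.Recorded P.k (.send c)) ∧
  (∀ d, E.mc.StabilizesWithin P.k d → (∀ e, d ≤ E.tLast e + P.tSig + P.δ) →
    ∀ c t j, E.sc.Honest j → E.sc.Stable P.k j t (.recv c) →
      ∀ i, E.mc.Honest i → E.mc.Stable P.k i t (.send c))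

/-- If the sending half is as expected, then eventually both halves are in blocks more than `k`
blocks away from the ends of the respective ledgers. -/
def Stability (E : Execution NM NS C X D) (P : Params) : Prop :=
  ∀ c, E.Initiated c → E.AsExpected (.send c) →
    E.mc.Recorded P.k (.send c) ∧ E.sc.Recorded P.k (.recv c)

def Secure (E : Execution NM NS C X D) (P : Params) : Prop :=
  E.Correctness P ∧ E.Stability P

end Execution

/-- The events `A n` fail with a probability that is negligible in `n`. -/
def Overwhelming {Ω : ℕ → Type} [∀ n, MeasurableSpace (Ω n)] (μ : ∀ n, Measure (Ω n))
    (A : ∀ n, Ω n → Prop) : Prop :=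
  Asymptotics.SuperpolynomialDecay atTop (fun n : ℕ => (n : ℝ))
    (fun n => (μ n).real {ω | ¬ A n ω})

end AsyncSC

namespace AsyncSC

/-! Five overwhelming events intersect in an overwhelming event, so it suffices to show that each
single run in this intersection is secure (`FollowsProtocol.secure`); that argument is
deterministic. Safety rests on intersecting majorities. A stable transaction was approved by some
honest node. For a sending half, this means that it was packed. For a receiving half, an honest
sidechain node accepted a proof; its quorum meets the honest majority of the committee, so an honest
signer is among those alleged. As the scheme is unbroken, this signer signed at least `δ` earlier,
and honest nodes sign only the packed sequence, at least `tSig` after the epoch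
(`Accepts.eq_ctxMsg`). The same time bounds, added up, give the claim that the sending half comes
first. For progress, sending halves are submitted by an honest committee member and become stable by
liveness. Receiving halves need the sequential check, hence an induction over epochs and, inside,
over positions in the packed sequence (`recorded_recv`). -/

/-! ### Overwhelming events -/

theorem Overwhelming.mono {Ω : ℕ → Type} [∀ n, MeasurableSpace (Ω n)] {μ : ∀ n, Measure (Ω n)}
    [∀ n, IsProbabilityMeasure (μ n)] {A B : ∀ n, Ω n → Prop} (hA : Overwhelming μ A)
    (h : ∀ n ω, A n ω → B n ω) : Overwhelming μ B := by
  refine Asymptotics.SuperpolynomialDecay.trans_abs_le hA fun n => ?_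
  rw [abs_of_nonneg measureReal_nonneg, abs_of_nonneg measureReal_nonneg]
  exact measureReal_mono fun ω hω hAω => hω (h n ω hAω)

theorem Overwhelming.and {Ω : ℕ → Type} [∀ n, MeasurableSpace (Ω n)] {μ : ∀ n, Measure (Ω n)}
    [∀ n, IsProbabilityMeasure (μ n)] {A B : ∀ n, Ω n → Prop} (hA : Overwhelming μ A)
    (hB : Overwhelming μ B) : Overwhelming μ fun n ω => A n ω ∧ B n ω := by
  refine Asymptotics.SuperpolynomialDecay.trans_abs_le
    (Asymptotics.SuperpolynomialDecay.add hA hB) fun n => ?_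
  simp only [Pi.add_apply]
  rw [abs_of_nonneg measureReal_nonneg,
    abs_of_nonneg (add_nonneg measureReal_nonneg measureReal_nonneg)]
  -- Union bound: the conjunction fails only where one of the conjuncts fails.
  refine (measureReal_mono fun ω hω => ?_).trans (measureReal_union_le _ _)
  exact not_and_or.mp hω

/-! ### Intersecting majorities -/

/-- Two strict majorities of the same set intersect. -/
theorem Majority.exists_and {N : Type} {S : Finset N} {p q : N → Prop} (hp : Majority S p)
    (hq : Majority S q) : ∃ i ∈ S, p i ∧ q i := by
  classical
  by_contra! h
  have hdisj : Disjoint {i ∈ (S : Set N) | p i} {i ∈ (S : Set N) | q i} :=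
    Set.disjoint_left.mpr fun i hi hi' => h i hi.1 hi.2 hi'.2
  have hfin (r : N → Prop) : {i ∈ (S : Set N) | r i}.Finite :=
    S.finite_toSet.subset (Set.sep_subset _ _)
  have hle := Set.ncard_le_ncard (t := (S : Set N))
    (Set.union_subset (Set.sep_subset _ p) (Set.sep_subset _ q)) S.finite_toSet
  rw [Set.ncard_union_eq hdisj (hfin p) (hfin q), Set.ncard_coe_finset] at hle
  unfold Majority at hp hq
  omega

theorem Majority.exists_mem {N : Type} {S : Finset N} {p : N → Prop} (hp : Majority S p) :
    ∃ i ∈ S, p i :=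
  let ⟨i, hi, h, _⟩ := hp.exists_and hp
  ⟨i, hi, h⟩

/-! ### Consequences of persistence and liveness -/

namespace Chain

variable {N T : Type} {L : Chain N T} {k : ℕ}

theorem Persistence.stable_mono (hL : L.Persistence k) {i : N} (hi : L.Honest i) {t t' : ℕ}
    (htt' : t ≤ t') {x : T} (h : L.Stable k i t x) : L.Stable k i t' x :=
  let ⟨h', b, hb, hx⟩ := h
  ⟨h', b, hL.2 i hi t t' htt' h' b hb, hx⟩

/-- Liveness gives each honest node its own time of stabilization. The organization is finite, so
these times have a maximum, and persistence keeps the transaction stable afterwards. -/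
theorem recorded_of_submit (hp : L.Persistence k) (hl : L.Liveness k) {i : N} (hi : L.Honest i)
    {s : ℕ} {x : T} (hs : L.submit i s x) : L.Recorded k x := by
  have h (j : N) : ∃ t, L.Honest j → L.Stable k j t x := by
    by_cases hj : L.Honest j
    · obtain ⟨t, -, ht⟩ := hl i hi s x hs j hj
      exact ⟨t, fun _ => ht⟩
    · exact ⟨0, fun h => absurd h hj⟩
  choose t ht using h
  exact ⟨L.org.sup t, fun u hu j hj =>
    hp.stable_mono hj ((Finset.le_sup hj.1).trans hu) (ht j hj)⟩

/-- Whatever is stable for an honest node has been approved by an honest node. -/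
theorem RecordsOnlyEndorsed.exists_honest (h : L.RecordsOnlyEndorsed k) (hm : L.HonestMajority)
    {i : N} (hi : L.Honest i) {t : ℕ} {x : T} (hx : L.Stable k i t x) :
    ∃ j, L.Honest j ∧ ∃ s ≤ t, L.endorse j s x :=
  let ⟨j, hj, hjh, hs⟩ := Majority.exists_and hm (h i hi t x hx)
  ⟨j, ⟨hj, hjh⟩, hs⟩

/-- A list of recorded transactions is eventually stable as a whole. -/
theorem eventually_stable_of_list {C : Type} (f : C → T) (l : List C)
    (h : ∀ c ∈ l, L.Recorded k (f c)) :
    ∀ᶠ t in atTop, ∀ c ∈ l, ∀ i, L.Honest i → L.Stable k i t (f c) := by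
  classical
  have := (Filter.eventually_all_finset l.toFinset (l := atTop)
    (p := fun c t => ∀ i, L.Honest i → L.Stable k i t (f c))).mpr fun c hc =>
      eventually_atTop.mpr (h c (List.mem_toFinset.mp hc))
  simpa using this

end Chain

/-! ### Proofs: existence, acceptance and authenticity -/

namespace Execution

variable {NM NS C X : Type} {D : DAS (ℕ × List C)} {E : Execution NM NS C X D}

theorem mem_ctxSet {e : ℕ} {c : C} : c ∈ E.ctxSet e ↔ c ∈ E.batch e ∧ E.agreed c := by
  classical
  rw [ctxSet, List.mem_filter]
  -- For both halves, being as expected unfolds to `E.agreed c`, so the filter condition is this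
  -- proposition twice.
  exact and_congr_right fun _ => (@decide_eq_true_iff _ _).trans and_self_iff

/-- A quorum contains an honest member of the committee. -/
theorem IsQuorum.exists_honest {e : ℕ} {Q : List NM} (hQ : E.IsQuorum e Q)
    (hsub : E.committee e ⊆ E.mc.org) (hm : Majority (E.committee e) (· ∈ E.mc.honest)) :
    ∃ q ∈ Q, E.mc.Honest q := by
  classical
  have hmaj : Majority (E.committee e) (· ∈ Q) := by
    have hset : {i ∈ (E.committee e : Set NM) | i ∈ Q} = (Q.toFinset : Set NM) := by
      ext i
      simpa using hQ.2.1 i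
    unfold Majority
    rw [hset, Set.ncard_coe_finset, List.toFinset_card_of_nodup hQ.1]
    exact hQ.2.2
  obtain ⟨q, hqc, hqQ, hqh⟩ := hmaj.exists_and hm
  exact ⟨q, hqQ, hsub hqc, hqh⟩

/-- The honest committee members form a quorum whose signatures verify. -/
theorem exists_quorumSigned (hD : D.Correct) {n : ℕ} {P : Params} (hset : E.SetUp n P)
    (hsign : E.SigningRule P) {e : ℕ} (hm : Majority (E.committee e) (· ∈ E.mc.honest)) :
    ∃ Q σ t, E.QuorumSigned e Q σ t := by
  classical
  obtain ⟨hpar, hkey, hcom⟩ := hset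
  have hsig (i : NM) : ∃ u σ, i ∈ E.committee e → E.mc.Honest i →
      E.signed i u (E.ctxMsg e) σ := by
    by_cases hi : i ∈ E.committee e ∧ E.mc.Honest i
    · obtain ⟨u, σ, h⟩ := hsign.1 e i hi.1 hi.2
      exact ⟨u, σ, fun _ _ => h⟩
    -- The type of signatures is not known to be inhabited; the default value for all other nodes is
    -- borrowed from an honest member.
    · obtain ⟨j, hj, hjh⟩ := hm.exists_mem
      obtain ⟨u, σ, -⟩ := hsign.1 e j hj ⟨(hcom e).1 hj, hjh⟩
      exact ⟨u, σ, fun h h' => absurd ⟨h, h'⟩ hi⟩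
  choose u σ hσ using hsig
  -- The quorum is the set of all honest members; the supremum also runs over default times of the
  -- others, which only makes it later.
  refine ⟨((E.committee e).filter (· ∈ E.mc.honest)).toList, σ, (E.committee e).sup u,
    ⟨Finset.nodup_toList _, fun q hq => ?_, ?_⟩, fun q hq => ?_⟩
  · exact (Finset.mem_filter.mp (Finset.mem_toList.mp hq)).1
  · have hcard : {i ∈ (E.committee e : Set NM) | i ∈ E.mc.honest} =
        ((E.committee e).filter (· ∈ E.mc.honest) : Set NM) := by
      ext i
      simp
    unfold Majority at hm
    rw [hcard, Set.ncard_coe_finset] at hm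
    rwa [Finset.length_toList]
  · obtain ⟨hqc, hqh⟩ := Finset.mem_filter.mp (Finset.mem_toList.mp hq)
    have hq' : E.mc.Honest q := ⟨(hcom e).1 hqc, hqh⟩
    have hs := hσ q hqc hq'
    obtain ⟨-, -, -, -, hsupp⟩ := hsign.2 q hq' _ _ _ hs
    exact ⟨⟨u q, Finset.le_sup hqc, hs⟩,
      (hD.2 _ _ _ _ _ hpar).1 _ _ (hkey q hq') _ _ hsupp⟩

/-- An honestly aggregated proof is accepted. -/
theorem AggregatedFrom.accepts (hD : D.Correct) {n : ℕ} {P : Params} (hset : E.SetUp n P)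
    {e : ℕ} {Q : List NM} {σ : NM → D.Sgn} {t : ℕ} {a : ACP D NM}
    (hQ : E.QuorumSigned e Q σ t) (ha : E.AggregatedFrom e Q σ a) : E.Accepts a := by
  obtain ⟨hs, hmsg, hapk, hout⟩ := ha
  have hfst : (Q.map fun q => (E.pk q, σ q)).map Prod.fst = Q.map E.pk := by simp
  have hne : (Q.map fun q => (E.pk q, σ q)) ≠ [] := by
    have := hQ.1.2.2
    intro h
    rw [List.map_eq_nil_iff.mp h] at this
    simp at this
  refine ⟨?_, ?_, ?_⟩
  · rw [hs, hmsg]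
    exact hQ.1
  · rw [hs]
    exact (hD.1 _ _).mpr hapk
  · have h := (hD.2 _ _ _ _ _ hset.1).2 (E.ctxMsg e) _ hne
      (by
        intro p hp
        obtain ⟨q, hq, rfl⟩ := List.mem_map.mp hp
        exact (hQ.2 q hq).2) (a.sig, a.prf, a.out) (by rw [hfst]; exact hout)
    rw [hfst] at h
    rw [hmsg, hapk]
    exact h

/-- Unless the signature scheme is broken, what an honest node of the sidechain accepts is the
packed sequence of an epoch that ended at least `tSig + δ` earlier. -/
theorem Accepts.eq_ctxMsg {n : ℕ} {P : Params} (hset : E.SetUp n P) (hsign : E.SigningRule P)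
    (hmaj : E.HonestMajorities) (hwin : ¬ E.dasAttack.Wins P.δ) {j : NS} (hj : E.sc.Honest j)
    {s : ℕ} {a : ACP D NM} (hr : E.received j s a) (ha : E.Accepts a) :
    a.msg = E.ctxMsg a.msg.1 ∧ E.packTime a.msg.1 + P.tSig + P.δ ≤ s := by
  obtain ⟨q, hq, hqh⟩ := ha.1.exists_honest (hset.2.2 _).1 (hmaj.2.2 _)
  have hsigned : ∃ u σ, u + P.δ ≤ s ∧ E.signed q u a.msg σ := by
    by_contra hno
    exact hwin ⟨s, a, ⟨j, hj, hr⟩, ha.2, q, hq, hqh, hno⟩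
  obtain ⟨u, σ, hu, hσ⟩ := hsigned
  obtain ⟨e, -, hmsg, hpack, -⟩ := hsign.2 q hqh u _ σ hσ
  -- The epoch number is part of the signed message, so the epoch signed for is the one the proof
  -- claims.
  have he : a.msg.1 = e := by rw [hmsg]; rfl
  rw [he]
  exact ⟨hmsg, by omega⟩

theorem RecvCheck.exists_mem_ctxSet {n : ℕ} {P : Params} (hset : E.SetUp n P)
    (hsign : E.SigningRule P) (hmaj : E.HonestMajorities) (hwin : ¬ E.dasAttack.Wins P.δ)
    {j : NS} (hj : E.sc.Honest j) {t : ℕ} {c : C} (h : E.RecvCheck P.k j t c) :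
    ∃ e, c ∈ E.ctxSet e ∧ E.packTime e + P.tSig + P.δ ≤ t := by
  obtain ⟨a, ⟨s, hst, hr⟩, ha, m, hm, -⟩ := h
  obtain ⟨hmsg, hs⟩ := ha.eq_ctxMsg hset hsign hmaj hwin hj hr
  refine ⟨a.msg.1, ?_, hs.trans hst⟩
  have hsnd : a.msg.2 = E.ctxSet a.msg.1 := congrArg Prod.snd hmsg
  rw [← hsnd]
  exact List.mem_of_getElem? hm

/-- A receiving half is stable for an honest node only after some honest node has found the
check to pass. -/
theorem exists_recvCheck {P : Params} (hmaj : E.HonestMajorities)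
    (hrec : E.sc.RecordsOnlyEndorsed P.k) (hcompl : E.CompletionRule P) {i : NS}
    (hi : E.sc.Honest i) {t : ℕ} {c : C} (h : E.sc.Stable P.k i t (.recv c)) :
    ∃ j, E.sc.Honest j ∧ ∃ s ≤ t, E.RecvCheck P.k j s c :=
  let ⟨j, hj, s, hs, he⟩ := hrec.exists_honest hmaj.2.1 hi h
  ⟨j, hj, s, hs, (hcompl j hj c).1 s (.inr he)⟩

/-- One honest node suffices: its passing check makes it submit, and liveness and persistence do the
rest. -/
theorem RecvCheck.recorded {P : Params} (hcompl : E.CompletionRule P)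
    (hp : E.sc.Persistence P.k) (hl : E.sc.Liveness P.k) {j : NS} (hj : E.sc.Honest j) {t : ℕ}
    {c : C} (h : E.RecvCheck P.k j t c) : E.sc.Recorded P.k (.recv c) :=
  let ⟨_, hs⟩ := (hcompl j hj c).2 t h
  Chain.recorded_of_submit hp hl hj hs

/-- In every epoch, the receiving halves get confirmed, or every honest node of the sidechain
obtains an acceptable proof. -/
theorem confirmed_or_received (hD : D.Correct) {n : ℕ} {P : Params} (hP : 0 < P.Δasync)
    (hset : E.SetUp n P) (hsign : E.SigningRule P) (htrans : E.TransmissionRule P)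
    (hmaj : E.HonestMajorities) (hdelay : E.FiniteDelay) (e : ℕ) :
    (∃ j t, E.sc.Honest j ∧ ∀ c ∈ E.ctxSet e, E.sc.Stable P.k j t (.recv c)) ∨
    ∃ a, a.msg = E.ctxMsg e ∧ E.Accepts a ∧ ∀ j, E.sc.Honest j → ∃ t, E.received j t a := by
  obtain ⟨i, hic, hih⟩ := (hmaj.2.2 e).exists_mem
  have hi : E.mc.Honest i := ⟨(hset.2.2 e).1 hic, hih⟩
  obtain ⟨Q, σ, t, r, a, hQ, -, -, ha, hsend⟩ := htrans.1 e i hic hi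
    (exists_quorumSigned hD hset hsign (hmaj.2.2 e))
  by_cases hconf : ∃ t, E.confirmed i e t
  · obtain ⟨t, ht⟩ := hconf
    obtain ⟨j, hj, h⟩ := htrans.2 i hi e t ht
    exact .inl ⟨j, t, hj, h⟩
  · refine .inr ⟨a, ha.2.1, ha.accepts hD hset hQ, fun j hj => hdelay i j hi hj a fun t₀ => ?_⟩
    -- As `Δasync` is positive, the retransmission number `t₀` takes place at time `t₀` or later; so
    -- sending goes on forever and the finite delay applies.
    exact ⟨r + t₀ * P.Δasync, (Nat.le_mul_of_pos_right t₀ hP).trans (Nat.le_add_left _ _),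
      hsend t₀ (fun h => hconf ⟨_, h⟩) j hj.1⟩

/-! ### Completion on the sidechain -/

/-- Strong induction on the epoch. If the epoch was confirmed, each half is already stable
somewhere, so an honest node's check has passed. Otherwise an honest node holds a valid proof, and a
second induction along the packed sequence makes its check pass for one half after another. -/
theorem recorded_recv (hD : D.Correct) {n : ℕ} {P : Params} (hP : 0 < P.Δasync)
    (hE : E.FollowsProtocol n P) (hmaj : E.HonestMajorities) (hdelay : E.FiniteDelay)
    (hp : E.sc.Persistence P.k) (hl : E.sc.Liveness P.k) (e : ℕ) :
    ∀ c ∈ E.ctxSet e, E.sc.Recorded P.k (.recv c) := by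
  obtain ⟨hset, -, hrec, -, hsign, htrans, hcompl⟩ := hE
  induction e using Nat.strong_induction_on with
  | _ e ih =>
  obtain ⟨j, t, hj, h⟩ | ⟨a, hmsg, hacc, hrcv⟩ :=
    confirmed_or_received hD hP hset hsign htrans hmaj hdelay e
  · intro c hc
    obtain ⟨j', hj', s, -, hcheck⟩ := exists_recvCheck hmaj hrec hcompl hj (h c hc)
    exact hcheck.recorded hcompl hp hl hj'
  · obtain ⟨j, hjo, hjh⟩ := Majority.exists_mem hmaj.2.1
    have hj : E.sc.Honest j := ⟨hjo, hjh⟩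
    obtain ⟨s, hs⟩ := hrcv j hj
    have hnth (m : ℕ) : ∀ c, (E.ctxSet e)[m]? = some c → E.sc.Recorded P.k (.recv c) := by
      induction m using Nat.strong_induction_on with
      | _ m ihm =>
      intro c hc
      have hpre : ∀ c' ∈ (E.ctxSet e).take m, E.sc.Recorded P.k (.recv c') := by
        intro c' hc'
        obtain ⟨m', hm', rfl⟩ := List.mem_take_iff_getElem.mp hc'
        exact ihm m' (by omega) _ (List.getElem?_eq_getElem _)
      -- Only finitely many transactions precede; joined into one list, they have a common time of
      -- stability.
      have hearlier : ∀ c' ∈ (List.range e).flatMap E.ctxSet,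
          E.sc.Recorded P.k (.recv c') := by
        intro c' hc'
        obtain ⟨e', he', hc'⟩ := List.mem_flatMap.mp hc'
        exact ih e' (List.mem_range.mp he') c' hc'
      -- A time when all preceding halves are stable and the proof has arrived: here the check
      -- passes.
      obtain ⟨t, h₁, h₂, hst⟩ := ((Chain.eventually_stable_of_list Tx.recv _ hpre).and
        ((Chain.eventually_stable_of_list Tx.recv _ hearlier).and
          (eventually_ge_atTop s))).exists
      refine RecvCheck.recorded hcompl hp hl hj (t := t)
        ⟨a, ⟨s, hst, hs⟩, hacc, m, ?_, ?_, ?_⟩ <;> rw [hmsg]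
      · exact hc
      · exact fun c' hc' => h₁ c' hc' j hj
      · exact fun e' he' c' hc' =>
          h₂ c' (List.mem_flatMap.mpr ⟨e', List.mem_range.mpr he', hc'⟩) j hj
    intro c hc
    obtain ⟨m, hm⟩ := List.mem_iff_getElem?.mp hc
    exact hnth m c hm

/-! ### Submission on the mainchain and security of a run -/

theorem exists_submit_send {n : ℕ} {P : Params} (hset : E.SetUp n P) (hinit : E.InitiationRule)
    (hmaj : E.HonestMajorities) {e : ℕ} {c : C} (hc : c ∈ E.ctxSet e) :
    ∃ i s, E.mc.Honest i ∧ s + E.tLast e ≤ E.packTime e ∧ E.mc.submit i s (.send c) := by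
  obtain ⟨i, hic, hih⟩ := (hmaj.2.2 e).exists_mem
  have hi : E.mc.Honest i := ⟨(hset.2.2 e).1 hic, hih⟩
  obtain ⟨s, hs, hsub⟩ := hinit.2 e i hic hi c hc
  exact ⟨i, s, hi, hs, hsub⟩

theorem FollowsProtocol.secure (hD : D.Correct) {n : ℕ} {P : Params} (hP : 0 < P.Δasync)
    (hE : E.FollowsProtocol n P) (hmaj : E.HonestMajorities) (hdelay : E.FiniteDelay)
    (hwin : ¬ E.dasAttack.Wins P.δ) (hmc : E.mc.Persistence P.k ∧ E.mc.Liveness P.k)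
    (hsc : E.sc.Persistence P.k ∧ E.sc.Liveness P.k) : E.Secure P := by
  have hrecv := recorded_recv hD hP hE hmaj hdelay hsc.1 hsc.2
  obtain ⟨hset, hrecm, hrecs, hinit, hsign, -, hcompl⟩ := hE
  have hsend (e : ℕ) (c : C) (hc : c ∈ E.ctxSet e) : E.mc.Recorded P.k (.send c) :=
    let ⟨_, _, hi, _, hs⟩ := exists_submit_send hset hinit hmaj hc
    Chain.recorded_of_submit hmc.1 hmc.2 hi hs
  have hpacked_send (c : C) (h : E.mc.Appears P.k (.send c)) : ∃ e, c ∈ E.ctxSet e := by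
    obtain ⟨t, i, hi, hst⟩ := h
    obtain ⟨j, hj, s, -, he⟩ := hrecm.exists_honest hmaj.1 hi hst
    exact hinit.1 j hj s c (.inr he)
  have hpacked_recv {c : C} {t : ℕ} {i : NS} (hi : E.sc.Honest i)
      (h : E.sc.Stable P.k i t (.recv c)) :
      ∃ e, c ∈ E.ctxSet e ∧ E.packTime e + P.tSig + P.δ ≤ t := by
    obtain ⟨j, hj, s, hs, hcheck⟩ := exists_recvCheck hmaj hrecs hcompl hi h
    obtain ⟨e, hc, he⟩ := hcheck.exists_mem_ctxSet hset hsign hmaj hwin hj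
    exact ⟨e, hc, he.trans hs⟩
  have hboth (c : C) (h : E.Initiated c) (ha : E.agreed c) :
      E.mc.Recorded P.k (.send c) ∧ E.sc.Recorded P.k (.recv c) := by
    obtain ⟨e, he⟩ := h
    have hc := mem_ctxSet.mpr ⟨he, ha⟩
    exact ⟨hsend e c hc, hrecv e c hc⟩
  refine ⟨⟨fun c h ha _ => hboth c h ha, fun c hc => ?_, fun c h => ?_, fun c h => ?_,
    fun d hd hle c t j hj hst i hi => ?_⟩, hboth⟩
  · have hna : ¬ E.agreed c := or_self_iff.mp hc
    refine ⟨fun h => ?_, fun ⟨t, i, hi, hst⟩ => ?_⟩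
    · obtain ⟨e, he⟩ := hpacked_send c h
      exact hna (mem_ctxSet.mp he).2
    · obtain ⟨e, he, -⟩ := hpacked_recv hi hst
      exact hna (mem_ctxSet.mp he).2
  · obtain ⟨e, he⟩ := hpacked_send c h
    exact hrecv e c he
  · obtain ⟨t, j, hj, hst⟩ := h
    obtain ⟨e, he, -⟩ := hpacked_recv hj hst
    exact hsend e c he
  · obtain ⟨e, he, hpack⟩ := hpacked_recv hj hst
    obtain ⟨i', s, hi', hs, hsub⟩ := exists_submit_send hset hinit hmaj he
    have := hle e
    -- With `e` the epoch that packed `c`: `s + tLast e ≤ packTime e`, `packTime e + tSig + δ ≤ t`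
    -- and `d ≤ tLast e + tSig + δ` add up to `s + d ≤ t`.
    exact hd i' hi' s _ hsub t (by omega) i hi

end Execution

end AsyncSC

theorem theorem1 {NM NS C X : Type} (D : AsyncSC.DAS (ℕ × List C)) (hD : D.Correct)
    (P : ℕ → AsyncSC.Params) (hP : ∀ n, 0 < (P n).Δasync)
    (Ω : ℕ → Type) [∀ n, MeasurableSpace (Ω n)] (μ : ∀ n, MeasureTheory.Measure (Ω n))
    [∀ n, MeasureTheory.IsProbabilityMeasure (μ n)]
    (E : ∀ n, Ω n → AsyncSC.Execution NM NS C X D)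
    (hE : ∀ n ω, (E n ω).FollowsProtocol n (P n))
    (hmajority : AsyncSC.Overwhelming μ fun n ω => (E n ω).HonestMajorities)
    (hdelay : AsyncSC.Overwhelming μ fun n ω => (E n ω).FiniteDelay)
    (hDAS : AsyncSC.Overwhelming μ fun n ω => ¬ (E n ω).dasAttack.Wins (P n).δ)
    (hmc : AsyncSC.Overwhelming μ fun n ω =>
      (E n ω).mc.Persistence (P n).k ∧ (E n ω).mc.Liveness (P n).k)
    (hsc : AsyncSC.Overwhelming μ fun n ω =>
      (E n ω).sc.Persistence (P n).k ∧ (E n ω).sc.Liveness (P n).k) :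
    AsyncSC.Overwhelming μ fun n ω => (E n ω).Secure (P n) :=
  ((((hmajority.and hdelay).and hDAS).and hmc).and hsc).mono
    fun n ω ⟨⟨⟨⟨h₁, h₂⟩, h₃⟩, h₄⟩, h₅⟩ => (hE n ω).secure hD (hP n) h₁ h₂ h₃ h₄ h₅
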